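/- \textbf{Theorem.} Let $X\in\mathbb{R}^{N\times d}$ be a data matrix with $N\ge 1$, and let $X=U\Sigma V^{\mathsf T}$ be a singular value decomposition (thin, full, or of an intermediate shape): $U$ and $V$ have orthonormal columns, $\Sigma$ is (rectangular) diagonal, and the singular values $\sigma_1\ge\sigma_2\ge\dots\ge 0$ are in decreasing order, with $\sigma_i=0$ beyond the size of $\Sigma$. Let $k\ge 1$ be at most the number of columns of $V$, let $V_k\in\mathbb{R}^{d\times k}$ consist of the first $k$ columns of $V$, and let $\ell^k_j=\sum_{i=1}^k V_{j,i}^2$, $j\in[d]=\{1,\dots,d\}$, be the $k$-leverage scores. Let $y=Xw^*+\xi\in\mathbb{R}^N$ with $w^*\in\mathbb{R}^d$ and $\xi_1,\dots,\xi_N$ i.i.d. with mean $0$ and (finite) variance $v$. The excess risk of an estimator $w=w(X,y)$ is $\mathcal{E}(w)=\mathbb{E}_\xi\big[\|Xw^*-Xw\|^2/N\big]$, where $\|\cdot\|$ is the Euclidean norm. For $S\subset[d]$ with sampling matrix $\mathbf{S}$ (that is, $M\mathbf{S}=M_{:,S}$ for every matrix $M$ with $d$ columns), the sketched least-squares estimator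 is $\hat w_S=\mathbf{S}(X\mathbf{S})^{+}y\in\mathbb{R}^d$, where ${}^+$ is the Moore--Penrose pseudo-inverse. Let $\theta>1$, let $\pi$ be a permutation of $[d]$ with $\ell^k_{\pi_1}\ge\dots\ge\ell^k_{\pi_d}$, and let $$p_{\mathrm{eff}}(\theta)=\min\Big\{q\in[d]\;:\;\sum_{i\le q}\ell^k_{\pi_i}\ge k-1+\frac1\theta\Big\}.$$ Let $S$ be a random subset of $[d]$ drawn from the projection DPP with marginal kernel $K=V_kV_k^{\mathsf T}$, i.e. $\mathbb{P}(T\subset S)=\det\big[(K_{i,j})_{i,j\in T}\big]$ for all $T\subset[d]$, and let $$\mathcal{A}_\theta=\big\{S\cap\{\pi_i : p_{\mathrm{eff}}(\theta)<i\le d\}=\emptyset\big\}.$$ Then $\mathbb{P}_{\mathrm{DPP}}(\mathcal{A}_\theta)>0$, and $$\mathbb{E}_{\mathrm{DPP}}\big[\mathcal{E}(\hat w_S)\,\big|\,\mathcal{A}_\theta\big]\;\le\;\big[1+(k-1+\theta)(p_{\mathrm{eff}}(\theta)-k+1)\big]\frac{\|w^*\|^2\sigma_{k+1}^2}{N}+\frac{vk}{N}.$$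 -/

import Mathlib

open Matrix MeasureTheory ProbabilityTheory

noncomputable section

namespace ColumnSubset

/-- The rectangular diagonal `n × m` matrix with diagonal entries `σ 0, σ 1, …`. -/
def rectDiagonal (n m : ℕ) (σ : ℕ → ℝ) : Matrix (Fin n) (Fin m) ℝ :=
  Matrix.of fun i j => if (i : ℕ) = (j : ℕ) then σ i else 0

/-- `X = U Σ Vᵀ` is a singular value decomposition of the real `N × d` matrix `X`: `U` and `V` have
orthonormal columns and the singular values `σ 0 ≥ σ 1 ≥ …` are nonnegative, so that the
`(i + 1)`-st singular value of `X` is `σ i` (equal to `0` beyond the size of `Σ`).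
The thin decomposition is the case `n = m = rank X`, the full one the case `n = N`, `m = d`. -/
structure IsSVD {N d n m : ℕ} (X : Matrix (Fin N) (Fin d) ℝ)
    (U : Matrix (Fin N) (Fin n) ℝ) (σ : ℕ → ℝ) (V : Matrix (Fin d) (Fin m) ℝ) : Prop where
  orthonormal_left : Uᵀ * U = 1
  orthonormal_right : Vᵀ * V = 1
  decomposition : X = U * rectDiagonal n m σ * Vᵀ
  antitone : Antitone σ
  nonneg : ∀ i, 0 ≤ σ i
  eq_zero : ∀ i, min n m ≤ i → σ i = 0

/-- The first `k` columns `V_k` of `V`. -/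
def firstCols {d m k : ℕ} (V : Matrix (Fin d) (Fin m) ℝ) (hk : k ≤ m) :
    Matrix (Fin d) (Fin k) ℝ :=
  V.submatrix id (Fin.castLE hk)

/-- The `k`-leverage score of index `j`: the squared Euclidean norm of the `j`-th row of `V_k`. -/
def leverage {d k : ℕ} (Vk : Matrix (Fin d) (Fin k) ℝ) (j : Fin d) : ℝ :=
  ∑ i, Vk j i ^ 2

/-- The effective sparsity level: the least `q ∈ {1, …, d}` such that the first `q` of the scores
`ℓ (π 0), ℓ (π 1), …` sum to at least `k - 1 + 1/θ`. -/
def effSparsity {d : ℕ} (k : ℕ) (ℓ : Fin d → ℝ) (π : Equiv.Perm (Fin d)) (θ : ℝ) : ℕ :=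
  sInf {q : ℕ | 1 ≤ q ∧ q ≤ d ∧
    (k : ℝ) - 1 + 1 / θ ≤ ∑ i ∈ Finset.univ.filter (fun i : Fin d => (i : ℕ) < q), ℓ (π i)}

/-- The indices that `π` ranks strictly after the first `q` ones. -/
def tail {d : ℕ} (π : Equiv.Perm (Fin d)) (q : ℕ) : Finset (Fin d) :=
  (Finset.univ.filter (fun i : Fin d => q ≤ (i : ℕ))).map π.toEmbedding

/-- The random subset `Y` of `[d]` is a determinantal point process with marginal kernel `K`. -/
structure IsDPP {Ω : Type*} [MeasurableSpace Ω] (P : Measure Ω) {d : ℕ}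
    (K : Matrix (Fin d) (Fin d) ℝ) (Y : Ω → Finset (Fin d)) : Prop where
  measurable : Measurable Y
  marginal : ∀ S : Finset (Fin d), P.real {ω | S ⊆ Y ω} =
    (K.submatrix (fun i : S => (i : Fin d)) (fun i : S => (i : Fin d))).det

/-- The Moore–Penrose pseudo-inverse `A⁺ = (AᵀA)⁺ Aᵀ` of a real matrix, where `(AᵀA)⁺` inverts the
nonzero eigenvalues of `AᵀA` in an orthonormal eigenbasis (recall `0⁻¹ = 0`). -/
def pinv {m n : Type*} [Fintype m] [Fintype n] [DecidableEq n] (A : Matrix m n ℝ) :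
    Matrix n m ℝ :=
  let hA : (Aᵀ * A).IsHermitian := isHermitian_conjTranspose_mul_self A
  (hA.eigenvectorUnitary : Matrix n n ℝ) * diagonal (fun i => (hA.eigenvalues i)⁻¹) *
    (hA.eigenvectorUnitary : Matrix n n ℝ)ᵀ * Aᵀ

/-- The four Penrose equations, which characterize the Moore–Penrose pseudo-inverse. -/
theorem pinv_penrose {m n : Type*} [Fintype m] [Fintype n] [DecidableEq n] (A : Matrix m n ℝ) :
    A * pinv A * A = A ∧ pinv A * A * pinv A = pinv A ∧
      (A * pinv A)ᵀ = A * pinv A ∧ (pinv A * A)ᵀ = pinv A * A := by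
  have hA : (Aᵀ * A).IsHermitian := isHermitian_conjTranspose_mul_self A
  obtain ⟨W, hW⟩ : ∃ W : Matrix n n ℝ, W = (hA.eigenvectorUnitary : Matrix n n ℝ) := ⟨_, rfl⟩
  obtain ⟨l, hl⟩ : ∃ l : n → ℝ, l = hA.eigenvalues := ⟨_, rfl⟩
  have hWW : Wᵀ * W = 1 := by
    rw [hW]; exact (Unitary.mem_iff.mp hA.eigenvectorUnitary.2).1
  have hG : Aᵀ * A = W * diagonal l * Wᵀ := by
    have h := hA.spectral_theorem
    rw [Unitary.conjStarAlgAut_apply] at h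
    rw [hW, hl]
    exact h
  have hp : pinv A = W * diagonal (fun i => (l i)⁻¹) * Wᵀ * Aᵀ := by
    rw [hW, hl]; rfl
  obtain ⟨Q, hQ⟩ : ∃ Q, Q = W * diagonal (fun i => (l i)⁻¹) * Wᵀ := ⟨_, rfl⟩
  rw [← hQ] at hp
  have hmul : ∀ a b : n → ℝ, (W * diagonal a * Wᵀ) * (W * diagonal b * Wᵀ) =
      W * diagonal (fun i => a i * b i) * Wᵀ := by
    intro a b
    rw [← diagonal_mul_diagonal]
    calc _ = W * diagonal a * (Wᵀ * W) * diagonal b * Wᵀ := by simp only [Matrix.mul_assoc]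
      _ = _ := by rw [hWW]; simp only [Matrix.mul_assoc, Matrix.one_mul]
  have hsym : ∀ a : n → ℝ, (W * diagonal a * Wᵀ)ᵀ = W * diagonal a * Wᵀ := by
    intro a
    simp [Matrix.transpose_mul, Matrix.mul_assoc]
  have hQt : Qᵀ = Q := by rw [hQ]; exact hsym _
  have hQG : Q * (Aᵀ * A) = W * diagonal (fun i => (l i)⁻¹ * l i) * Wᵀ := by
    rw [hQ, hG, hmul]
  have hQGt : (Q * (Aᵀ * A))ᵀ = Q * (Aᵀ * A) := by rw [hQG]; exact hsym _
  have hGQG : (Aᵀ * A) * (Q * (Aᵀ * A)) = Aᵀ * A := by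
    rw [hQG, hG, hmul]
    congr 3
    funext i
    by_cases h : l i = 0 <;> simp [h]
  have hQGQ : Q * (Aᵀ * A) * Q = Q := by
    rw [hQG, hQ, hmul]
    congr 3
    funext i
    by_cases h : l i = 0 <;> simp [h]
  have h1 : A * (Q * (Aᵀ * A)) = A := by
    have hB : (A * (Q * (Aᵀ * A)) - A)ᵀ * (A * (Q * (Aᵀ * A)) - A) = 0 := by
      have : (A * (Q * (Aᵀ * A)) - A)ᵀ * (A * (Q * (Aᵀ * A)) - A) =
          (Q * (Aᵀ * A))ᵀ * ((Aᵀ * A) * (Q * (Aᵀ * A)) - Aᵀ * A) -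
            ((Aᵀ * A) * (Q * (Aᵀ * A)) - Aᵀ * A) := by
        rw [Matrix.transpose_sub, Matrix.transpose_mul A, Matrix.sub_mul, Matrix.mul_sub,
          Matrix.mul_sub, Matrix.mul_sub]
        simp only [Matrix.mul_assoc]
      rw [this, hGQG]; simp
    exact sub_eq_zero.mp (conjTranspose_mul_self_eq_zero.mp hB)
  refine ⟨?_, ?_, ?_, ?_⟩
  · rw [hp]
    simpa only [Matrix.mul_assoc] using h1
  · rw [hp]
    calc Q * Aᵀ * A * (Q * Aᵀ) = (Q * (Aᵀ * A) * Q) * Aᵀ := by simp only [Matrix.mul_assoc]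
      _ = _ := by rw [hQGQ]
  · rw [hp]
    simp [Matrix.transpose_mul, hQt, Matrix.mul_assoc]
  · rw [hp, Matrix.mul_assoc, hQGt]

/-- The sampling matrix of `S ⊆ [d]`, with columns indexed by `S`; `M * sampling S` is `M_{:,S}`. -/
def sampling {d : ℕ} (S : Finset (Fin d)) : Matrix (Fin d) S ℝ :=
  (1 : Matrix (Fin d) (Fin d) ℝ).submatrix id (fun i : S => (i : Fin d))

/-- The sketched least-squares estimator `ŵ_S = S (X S)⁺ y`. -/
def sketchedLS {N d : ℕ} (X : Matrix (Fin N) (Fin d) ℝ) (S : Finset (Fin d))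
    (y : EuclideanSpace ℝ (Fin N)) : EuclideanSpace ℝ (Fin d) :=
  WithLp.toLp 2 (sampling S *ᵥ (pinv (X * sampling S) *ᵥ y.ofLp))

/-- The excess risk `𝔼_ξ [‖X w⋆ - X ŵ(y)‖² / N]` of an estimator `ŵ`, a function of the response
`y = X w⋆ + ξ`. -/
def excessRisk {Ω : Type*} [MeasurableSpace Ω] (Q : Measure Ω) {N d : ℕ}
    (ξ : Fin N → Ω → ℝ) (X : Matrix (Fin N) (Fin d) ℝ) (wstar : EuclideanSpace ℝ (Fin d))
    (est : EuclideanSpace ℝ (Fin N) → EuclideanSpace ℝ (Fin d)) : ℝ :=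
  ∫ ω, ‖X.toEuclideanLin wstar -
    X.toEuclideanLin (est (X.toEuclideanLin wstar + WithLp.toLp 2 (fun i => ξ i ω)))‖ ^ 2 / N ∂Q

end ColumnSubset

end

noncomputable section

/-! Write `G_T` for the Gram matrix `∑ r ∈ T, vᵣ vᵣᵀ` of the rows of `V_k` indexed by `T`. The DPP
almost surely has `k` elements and takes the value `T` with probability `det G_T`. The conditioning
event is `S ⊆ L`, with `L` the first `p` indices; by Cauchy–Binet its probability is `det G_L`.

For fixed `T` with `G_T` invertible, the variance term is at most `vk/N`, as the fit is a projection
of rank at most `k`. For the bias, some vector supported on `T` agrees with `w⋆` on the top `k`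
right singular directions, so only `σ_{k+1}` acts on the difference, whose squared norm is at most
`(1 + tr G_T⁻¹) ‖w⋆‖²` (`exists_sampling_comparison`).

It remains to average `tr G_T⁻¹`. The weight `det G_T` turns it into `tr adj G_T`, a sum of Gram
determinants with one column deleted; Cauchy–Binet and double counting give `∑ T, tr adj G_T = (p -
k + 1) tr adj G_L` (`sum_trace_adjugate_rowGram`). Finally `G_L ≤ 1` and `tr G_L ≥ k - 1 + 1/θ`
force `tr G_L⁻¹ ≤ k - 1 + θ` (`trace_adjugate_rowGram_le`). -/

namespace ColumnSubset

/-! ### Gram determinants and Cauchy–Binet. -/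

/-- The Gram matrix `∑ r ∈ R, aᵣ aᵣᵀ` of the rows of `A` with index in `R`. -/
def rowGram {ι n : Type*} (A : Matrix ι n ℝ) (R : Finset ι) : Matrix n n ℝ :=
  Matrix.of fun i j => ∑ r ∈ R, A r i * A r j

/-- Row `i` of the Gram matrix is a sum of multiples of the rows of `A`. Multilinearity expands the
determinant over choice functions `f`; a repeated choice makes two rows proportional to the same
vector and contributes zero. -/
theorem det_rowGram_eq_sum_injective {ι n : Type*} [DecidableEq ι] [Fintype n] [DecidableEq n]
    (A : Matrix ι n ℝ) (L : Finset ι) :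
    (rowGram A L).det = ∑ f ∈ (Fintype.piFinset fun _ : n => L).filter Function.Injective,
      (Matrix.of fun i j => A (f i) i * A (f i) j).det := by
  have h1 : (rowGram A L).det = ∑ f ∈ Fintype.piFinset fun _ : n => L,
      (Matrix.of fun i j => A (f i) i * A (f i) j).det := by
    have h := (detRowAlternating : (n → ℝ) [⋀^n]→ₗ[ℝ] ℝ).toMultilinearMap.map_sum_finset
      (fun i r => fun j => A r i * A r j) (fun _ => L)
    have h2 : rowGram A L = fun i => ∑ r ∈ L, fun j => A r i * A r j := by
      ext i j
      simp [rowGram, Finset.sum_apply]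
    rw [h2]
    exact h
  rw [h1, Finset.sum_filter_of_ne]
  intro f _ hf a b hab
  by_contra hne
  refine hf ?_
  have : (Matrix.of fun i j => A (f i) i * A (f i) j).det =
      (∏ i, A (f i) i) * (A.submatrix f id).det := by
    rw [← det_mul_column]
    rfl
  rw [this, det_zero_of_row_eq hne, mul_zero]
  ext j
  simp [hab]

/-- The Cauchy–Binet formula for Gram matrices. -/
theorem det_rowGram_eq_sum_powersetCard {ι n : Type*} [DecidableEq ι] [Fintype n] [DecidableEq n]
    (A : Matrix ι n ℝ) (L : Finset ι) :
    (rowGram A L).det = ∑ R ∈ L.powersetCard (Fintype.card n), (rowGram A R).det := by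
  -- Group the injective choices by their image `R`. An injection into `R` has image exactly `R` by
  -- cardinality, so each fibre is the same expansion for `R`.
  rw [det_rowGram_eq_sum_injective, ← Finset.sum_fiberwise_of_maps_to
    (s := (Fintype.piFinset fun _ : n => L).filter Function.Injective)
    (t := L.powersetCard (Fintype.card n)) (g := fun f => Finset.univ.image f)]
  · refine Finset.sum_congr rfl fun R hR => ?_
    rw [det_rowGram_eq_sum_injective]
    refine Finset.sum_congr ?_ fun _ _ => rfl
    rw [Finset.mem_powersetCard] at hR
    ext f
    simp only [Finset.mem_filter, Fintype.mem_piFinset]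
    constructor
    · rintro ⟨⟨_, hf⟩, rfl⟩
      exact ⟨fun a => Finset.mem_image_of_mem _ (Finset.mem_univ _), hf⟩
    · rintro ⟨h, hf⟩
      refine ⟨⟨fun a => hR.1 (h a), hf⟩, Finset.eq_of_subset_of_card_le ?_ ?_⟩
      · intro x hx
        obtain ⟨a, _, rfl⟩ := Finset.mem_image.mp hx
        exact h a
      · rw [Finset.card_image_of_injective _ hf, hR.2, Finset.card_univ]
  · intro f hf
    simp only [Finset.mem_filter, Fintype.mem_piFinset] at hf
    rw [Finset.mem_powersetCard, Finset.card_image_of_injective _ hf.2, Finset.card_univ]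
    refine ⟨fun x hx => ?_, rfl⟩
    obtain ⟨a, _, rfl⟩ := Finset.mem_image.mp hx
    exact hf.1 a

/-- Double counting: a `k`-subset `R` of `L` extends to a `(k + 1)`-subset by any one of the `|L| -
k` elements of `L \ R`. -/
theorem sum_powersetCard_succ_sum_powersetCard {ι : Type*} [DecidableEq ι] (L : Finset ι) (k : ℕ)
    (h : Finset ι → ℝ) :
    ∑ T ∈ L.powersetCard (k + 1), ∑ R ∈ T.powersetCard k, h R =
      ((L.card : ℝ) - k) * ∑ R ∈ L.powersetCard k, h R := by
  rw [Finset.sum_comm' (t' := L.powersetCard k)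
    (s' := fun R => (L.powersetCard (k + 1)).filter (R ⊆ ·)), Finset.mul_sum]
  · refine Finset.sum_congr rfl fun R hR => ?_
    rw [Finset.mem_powersetCard] at hR
    have hc : (L.powersetCard (k + 1)).filter (R ⊆ ·) = (L \ R).image (insert · R) := by
      ext T
      simp only [Finset.mem_filter, Finset.mem_powersetCard, Finset.mem_image, Finset.mem_sdiff]
      constructor
      · rintro ⟨⟨hTL, hT⟩, hRT⟩
        have h1 : (T \ R).card = 1 := by rw [Finset.card_sdiff_of_subset hRT, hT, hR.2]; omega
        obtain ⟨a, ha⟩ := Finset.card_eq_one.mp h1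
        have ha' : a ∈ T \ R := by rw [ha]; simp
        rw [Finset.mem_sdiff] at ha'
        refine ⟨a, ⟨hTL ha'.1, ha'.2⟩, ?_⟩
        rw [Finset.insert_eq, ← ha, Finset.sdiff_union_of_subset hRT]
      · rintro ⟨a, ⟨haL, haR⟩, rfl⟩
        exact ⟨⟨Finset.insert_subset haL hR.1, by rw [Finset.card_insert_of_notMem haR, hR.2]⟩,
          Finset.subset_insert _ _⟩
    rw [Finset.sum_const, hc, Finset.card_image_of_injOn, Finset.card_sdiff_of_subset hR.1, hR.2,
      nsmul_eq_mul, Nat.cast_sub (hR.2 ▸ Finset.card_le_card hR.1)]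
    intro a ha b hb hab
    simp only [Finset.coe_sdiff, Set.mem_sdiff, Finset.mem_coe] at ha hb
    have : a ∈ insert b R := by
      have hab' : insert a R = insert b R := hab
      rw [← hab']; exact Finset.mem_insert_self _ _
    exact (Finset.mem_insert.mp this).resolve_right ha.2
  · intro T R
    simp only [Finset.mem_filter, Finset.mem_powersetCard]
    constructor
    · rintro ⟨⟨h1, h2⟩, h3, h4⟩
      exact ⟨⟨⟨h1, h2⟩, h3⟩, h3.trans h1, h4⟩
    · rintro ⟨⟨⟨h1, h2⟩, h3⟩, -, h4⟩
      exact ⟨⟨h1, h2⟩, h3, h4⟩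

/-! ### Quadratic form and adjugate trace of a Gram matrix. -/

theorem isHermitian_rowGram {ι n : Type*} (A : Matrix ι n ℝ) (R : Finset ι) :
    (rowGram A R).IsHermitian := by
  ext i j
  simp [rowGram, mul_comm]

theorem dotProduct_rowGram_mulVec {ι n : Type*} [Fintype n] (A : Matrix ι n ℝ) (R : Finset ι)
    (x : n → ℝ) : x ⬝ᵥ (rowGram A R *ᵥ x) = ∑ r ∈ R, (∑ j, A r j * x j) ^ 2 := by
  calc x ⬝ᵥ (rowGram A R *ᵥ x) = ∑ i, ∑ j, ∑ r ∈ R, (A r i * x i) * (A r j * x j) := by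
        simp only [dotProduct, mulVec, rowGram, Matrix.of_apply, Finset.sum_mul, Finset.mul_sum]
        refine Finset.sum_congr rfl fun i _ => Finset.sum_congr rfl fun j _ =>
          Finset.sum_congr rfl fun r _ => by ring
    _ = ∑ i, ∑ r ∈ R, ∑ j, (A r i * x i) * (A r j * x j) :=
        Finset.sum_congr rfl fun i _ => Finset.sum_comm
    _ = ∑ r ∈ R, ∑ i, ∑ j, (A r i * x i) * (A r j * x j) := Finset.sum_comm
    _ = _ := by simp only [sq, Finset.sum_mul_sum]

theorem trace_rowGram {ι n : Type*} [Fintype n] (A : Matrix ι n ℝ) (R : Finset ι) :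
    (rowGram A R).trace = ∑ r ∈ R, ∑ i, A r i ^ 2 := by
  simp only [Matrix.trace, diag_apply, rowGram, Matrix.of_apply, sq]
  rw [Finset.sum_comm]

theorem det_rowGram_nonneg {ι n : Type*} [Fintype n] [DecidableEq n] (A : Matrix ι n ℝ)
    (R : Finset ι) : 0 ≤ (rowGram A R).det := by
  have h : rowGram A R = (A.submatrix (fun r : R => (r : ι)) id)ᴴ *
      A.submatrix (fun r : R => (r : ι)) id := by
    ext i j
    exact (Finset.sum_coe_sort R fun r => A r i * A r j).symm
  rw [h]
  exact (posSemidef_conjTranspose_mul_self _).det_nonneg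

/-- A diagonal cofactor of a Gram matrix is the Gram determinant of `A` with that column removed, so
Cauchy–Binet applies to it again. -/
theorem trace_adjugate_rowGram {ι : Type*} {k : ℕ} (A : Matrix ι (Fin (k + 1)) ℝ)
    (T : Finset ι) : (rowGram A T).adjugate.trace =
      ∑ j : Fin (k + 1), (rowGram (A.submatrix id j.succAbove) T).det := by
  rw [Matrix.trace]
  refine Finset.sum_congr rfl fun j _ => ?_
  rw [diag_apply, adjugate_fin_succ_eq_det_submatrix, ← two_mul, pow_mul, neg_one_sq, one_pow,
    one_mul]
  rfl

theorem trace_adjugate_rowGram_nonneg {ι : Type*} {k : ℕ} (A : Matrix ι (Fin k) ℝ)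
    (T : Finset ι) : 0 ≤ (rowGram A T).adjugate.trace := by
  cases k with
  | zero => simp [Matrix.trace]
  | succ k =>
    rw [trace_adjugate_rowGram]
    exact Finset.sum_nonneg fun j _ => det_rowGram_nonneg _ _

/-- Each cofactor expands over `(k - 1)`-subsets `R`, and each `R ⊆ L` lies in `|L| - k + 1` sets
`T`. Working with adjugates avoids inverting singular `G_T`. -/
theorem sum_trace_adjugate_rowGram {ι : Type*} [DecidableEq ι] {k : ℕ} (hk : 0 < k)
    (A : Matrix ι (Fin k) ℝ) (L : Finset ι) :
    ∑ T ∈ L.powersetCard k, (rowGram A T).adjugate.trace =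
      ((L.card : ℝ) - k + 1) * (rowGram A L).adjugate.trace := by
  obtain ⟨k, rfl⟩ := Nat.exists_eq_succ_of_ne_zero hk.ne'
  have hcb : ∀ (j : Fin (k + 1)) T, (rowGram (A.submatrix id j.succAbove) T).det =
      ∑ R ∈ T.powersetCard k, (rowGram (A.submatrix id j.succAbove) R).det := by
    intro j T
    have h := det_rowGram_eq_sum_powersetCard (A.submatrix id j.succAbove) T
    rwa [Fintype.card_fin] at h
  simp_rw [trace_adjugate_rowGram]
  rw [Finset.sum_comm, Finset.mul_sum]
  refine Finset.sum_congr rfl fun j _ => ?_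
  rw [hcb j L, Finset.sum_congr rfl fun T _ => hcb j T, sum_powersetCard_succ_sum_powersetCard]
  push_cast
  ring

/-! ### The inverse trace on a set of nearly full leverage. -/

theorem dotProduct_rowGram_mulVec_le {d k : ℕ} {V : Matrix (Fin d) (Fin k) ℝ} (hV : Vᵀ * V = 1)
    (L : Finset (Fin d)) (x : Fin k → ℝ) : x ⬝ᵥ (rowGram V L *ᵥ x) ≤ x ⬝ᵥ x := by
  have h1 : rowGram V Finset.univ = 1 := by
    rw [← hV]
    rfl
  have h2 : x ⬝ᵥ (rowGram V Finset.univ *ᵥ x) = x ⬝ᵥ x := by rw [h1, one_mulVec]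
  rw [← h2, dotProduct_rowGram_mulVec, dotProduct_rowGram_mulVec]
  exact Finset.sum_le_sum_of_subset_of_nonneg (Finset.subset_univ _) fun _ _ _ => sq_nonneg _

/-- The defects `1 - l i` are nonnegative with sum at most `1 - 1/θ`, so every `l i` lies in `[1/θ,
1]`, where the convex function `1/x` is below its chord `1 + θ (1 - x)`. -/
theorem sum_inv_le_of_sum_ge {k : ℕ} {θ : ℝ} (hθ : 1 < θ) (l : Fin k → ℝ) (h1 : ∀ i, l i ≤ 1)
    (hs : (k : ℝ) - 1 + 1 / θ ≤ ∑ i, l i) :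
    (∀ i, 0 < l i) ∧ ∑ i, (l i)⁻¹ ≤ (k : ℝ) - 1 + θ := by
  have hθ0 : 0 < θ := by linarith
  have hsum : ∑ i, (1 - l i) ≤ 1 - 1 / θ := by
    rw [Finset.sum_sub_distrib]
    simp only [Finset.sum_const, Finset.card_univ, Fintype.card_fin, nsmul_eq_mul, mul_one]
    linarith
  have hlow : ∀ i, 1 / θ ≤ l i := by
    intro i
    have := Finset.single_le_sum (f := fun i => 1 - l i) (fun j _ => sub_nonneg.mpr (h1 j))
      (Finset.mem_univ i)
    linarith
  have hpos : ∀ i, 0 < l i := fun i => lt_of_lt_of_le (by positivity) (hlow i)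
  refine ⟨hpos, ?_⟩
  have hle : ∀ i, (l i)⁻¹ ≤ 1 + θ * (1 - l i) := by
    intro i
    have h2 : 1 ≤ θ * l i := by
      have := mul_le_mul_of_nonneg_left (hlow i) hθ0.le
      rwa [mul_one_div_cancel hθ0.ne'] at this
    rw [inv_le_iff_one_le_mul₀ (hpos i)]
    -- The claim is `(θ l - 1)(1 - l) ≥ 0`.
    nlinarith [mul_nonneg (sub_nonneg.mpr h2) (sub_nonneg.mpr (h1 i))]
  calc ∑ i, (l i)⁻¹ ≤ ∑ i, (1 + θ * (1 - l i)) := Finset.sum_le_sum fun i _ => hle i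
    _ = k + θ * ∑ i, (1 - l i) := by
        rw [Finset.sum_add_distrib, Finset.mul_sum]
        simp
    _ ≤ k + θ * (1 - 1 / θ) := by gcongr
    _ = _ := by field_simp; ring

/-- The eigenvalues of `G_L` are at most `1` because `G_L` omits rows from the Gram matrix `1`, and
they sum to the leverage of `L`. So `sum_inv_le_of_sum_ge` bounds `tr G_L⁻¹`, and `adj G = det G •
G⁻¹`. -/
theorem trace_adjugate_rowGram_le {d k : ℕ} {V : Matrix (Fin d) (Fin k) ℝ} (hV : Vᵀ * V = 1)
    (L : Finset (Fin d)) {θ : ℝ} (hθ : 1 < θ)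
    (hs : (k : ℝ) - 1 + 1 / θ ≤ ∑ r ∈ L, leverage V r) :
    0 < (rowGram V L).det ∧
      (rowGram V L).adjugate.trace ≤ ((k : ℝ) - 1 + θ) * (rowGram V L).det := by
  have hG := isHermitian_rowGram V L
  have htr := trace_rowGram V L
  obtain ⟨G, hGdef⟩ : ∃ G, G = rowGram V L := ⟨_, rfl⟩
  have hquad : ∀ x : Fin k → ℝ, x ⬝ᵥ (G *ᵥ x) ≤ x ⬝ᵥ x := by
    rw [hGdef]; exact dotProduct_rowGram_mulVec_le hV L
  rw [← hGdef] at hG htr ⊢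
  have hl1 : ∀ i, hG.eigenvalues i ≤ 1 := by
    intro i
    have hx := hquad (hG.eigenvectorBasis i).ofLp
    rw [hG.mulVec_eigenvectorBasis i, dotProduct_smul] at hx
    have hn : (hG.eigenvectorBasis i).ofLp ⬝ᵥ (hG.eigenvectorBasis i).ofLp = 1 := by
      have h := hG.eigenvectorBasis.orthonormal.1 i
      have h2 := EuclideanSpace.real_norm_sq_eq (hG.eigenvectorBasis i)
      rw [h] at h2
      simp only [dotProduct, ← sq]
      linarith
    rw [hn] at hx
    simpa using hx
  have hsum : (k : ℝ) - 1 + 1 / θ ≤ ∑ i, hG.eigenvalues i := by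
    have := hG.trace_eq_sum_eigenvalues
    simp only [RCLike.ofReal_real_eq_id, id_eq] at this
    rw [← this, htr]
    exact hs
  obtain ⟨hpos, hle⟩ := sum_inv_le_of_sum_ge hθ hG.eigenvalues hl1 hsum
  have hdet : 0 < G.det := by
    rw [hG.det_eq_prod_eigenvalues]
    simpa using Finset.prod_pos fun i _ => hpos i
  refine ⟨hdet, ?_⟩
  obtain ⟨W, hW⟩ : ∃ W : Matrix (Fin k) (Fin k) ℝ, W = (hG.eigenvectorUnitary : Matrix _ _ ℝ) :=
    ⟨_, rfl⟩
  have hWW : Wᵀ * W = 1 := by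
    rw [hW]; exact (Unitary.mem_iff.mp hG.eigenvectorUnitary.2).1
  have hspec : G = W * diagonal hG.eigenvalues * Wᵀ := by
    have h := hG.spectral_theorem
    rw [Unitary.conjStarAlgAut_apply] at h
    rw [hW]
    exact h
  obtain ⟨l, hl⟩ : ∃ l : Fin k → ℝ, l = hG.eigenvalues := ⟨_, rfl⟩
  rw [← hl] at hpos hle hspec
  have hinv : (W * diagonal (fun i => (l i)⁻¹) * Wᵀ) * G = 1 := by
    have hW' : W * Wᵀ = 1 := mul_eq_one_comm.mp hWW
    conv_lhs => rw [hspec]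
    calc _ = W * diagonal (fun i => (l i)⁻¹) * (Wᵀ * W) *
          diagonal l * Wᵀ := by simp only [Matrix.mul_assoc]
      _ = W * (diagonal (fun i => (l i)⁻¹) * diagonal l) * Wᵀ := by
          rw [hWW]; simp only [Matrix.mul_assoc, Matrix.one_mul]
      _ = 1 := by
          rw [diagonal_mul_diagonal]
          have : (fun i => (l i)⁻¹ * l i) = fun _ => 1 := by
            funext i
            exact inv_mul_cancel₀ (hpos i).ne'
          rw [this, diagonal_one, Matrix.mul_one, hW']
  have hadj : G.adjugate = G.det • (W * diagonal (fun i => (l i)⁻¹) * Wᵀ) := by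
    calc G.adjugate = (W * diagonal (fun i => (l i)⁻¹) * Wᵀ) * G * G.adjugate := by
          rw [hinv, Matrix.one_mul]
      _ = _ := by rw [Matrix.mul_assoc, mul_adjugate, Matrix.mul_smul, Matrix.mul_one]
  rw [hadj, trace_smul, Matrix.trace_mul_cycle, hWW, Matrix.one_mul, trace_diagonal, smul_eq_mul,
    mul_comm]
  gcongr

/-! ### Projections and Cauchy–Schwarz inequalities. -/

theorem mulVec_dotProduct_mulVec {m n : Type*} [Fintype m] [Fintype n] (A : Matrix m n ℝ)
    (x y : n → ℝ) : (A *ᵥ x) ⬝ᵥ (A *ᵥ y) = x ⬝ᵥ ((Aᵀ * A) *ᵥ y) := by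
  rw [← mulVec_mulVec, dotProduct_mulVec x, vecMul_transpose]

theorem dotProduct_self_nonneg_real {n : Type*} [Fintype n] (x : n → ℝ) : 0 ≤ x ⬝ᵥ x :=
  Finset.sum_nonneg fun i _ => mul_self_nonneg (x i)

theorem dotProduct_projection_compl_le {n : Type*} [Fintype n] [DecidableEq n] {R : Matrix n n ℝ}
    (hs : Rᵀ = R) (hi : R * R = R) (x : n → ℝ) :
    (x - R *ᵥ x) ⬝ᵥ (x - R *ᵥ x) = x ⬝ᵥ x - (R *ᵥ x) ⬝ᵥ (R *ᵥ x) := by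
  have h : (R *ᵥ x) ⬝ᵥ (R *ᵥ x) = x ⬝ᵥ (R *ᵥ x) := by
    rw [mulVec_dotProduct_mulVec, hs, hi]
  rw [sub_dotProduct, dotProduct_sub, dotProduct_sub, dotProduct_comm (R *ᵥ x) x, h]
  ring

theorem mulVec_dotProduct_mulVec_le_frobenius {m n : Type*} [Fintype m] [Fintype n]
    (F : Matrix m n ℝ) (b : n → ℝ) :
    (F *ᵥ b) ⬝ᵥ (F *ᵥ b) ≤ (Fᵀ * F).trace * (b ⬝ᵥ b) := by
  have htr : (Fᵀ * F).trace = ∑ i, ∑ j, F i j ^ 2 := by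
    simp only [Matrix.trace, diag_apply, Matrix.mul_apply, transpose_apply, ← sq]
    exact Finset.sum_comm
  rw [htr, Finset.sum_mul]
  refine Finset.sum_le_sum fun i _ => ?_
  rw [← sq]
  have := Finset.sum_mul_sq_le_sq_mul_sq Finset.univ (F i) b
  simpa only [mulVec, dotProduct, ← sq] using this

theorem dotProduct_sq_le {n : Type*} [Fintype n] (a q : n → ℝ) :
    (a ⬝ᵥ q) ^ 2 ≤ (a ⬝ᵥ a) * (q ⬝ᵥ q) := by
  simpa only [dotProduct, ← sq] using Finset.sum_mul_sq_le_sq_mul_sq Finset.univ a q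

/-! ### The data matrix off its top singular directions. -/

section SingularValues

variable {N d n m : ℕ}

theorem rectDiagonal_mulVec_le {k : ℕ} {σ : ℕ → ℝ} (hσ : Antitone σ) (hσ0 : ∀ i, 0 ≤ σ i)
    (c : Fin m → ℝ) (hc : ∀ j : Fin m, (j : ℕ) < k → c j = 0) :
    (rectDiagonal n m σ *ᵥ c) ⬝ᵥ (rectDiagonal n m σ *ᵥ c) ≤ σ k ^ 2 * (c ⬝ᵥ c) := by
  -- The indicator sum is `c i ^ 2` when `i < m` and `0` otherwise, which treats all shapes of `Σ`
  -- at once.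
  have hi : ∀ i : Fin n, (rectDiagonal n m σ *ᵥ c) i * (rectDiagonal n m σ *ᵥ c) i ≤
      σ k ^ 2 * ∑ j : Fin m, if (i : ℕ) = (j : ℕ) then c j ^ 2 else 0 := by
    intro i
    simp only [mulVec, dotProduct, rectDiagonal, Matrix.of_apply, ite_mul, zero_mul]
    by_cases him : (i : ℕ) < m
    · have hsingle : ∀ f : Fin m → ℝ,
          (∑ j : Fin m, if (i : ℕ) = (j : ℕ) then f j else 0) = f ⟨i, him⟩ := by
        intro f
        rw [Finset.sum_eq_single ⟨i, him⟩]
        · simp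
        · intro j _ hj
          rw [if_neg]
          exact fun h => hj (Fin.ext h.symm)
        · simp
      rw [hsingle, hsingle]
      by_cases hik : (i : ℕ) < k
      · rw [hc ⟨i, him⟩ hik]; simp
      · have h1 : σ i ^ 2 ≤ σ k ^ 2 :=
          pow_le_pow_left₀ (hσ0 _) (hσ (not_lt.mp hik)) 2
        nlinarith [mul_le_mul_of_nonneg_right h1 (sq_nonneg (c ⟨i, him⟩))]
    · have hz : ∀ f : Fin m → ℝ, (∑ j : Fin m, if (i : ℕ) = (j : ℕ) then f j else 0) = 0 := by
        intro f
        refine Finset.sum_eq_zero fun j _ => if_neg fun h => him ?_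
        rw [h]; exact j.2
      rw [hz, hz]
      simp
  refine (Finset.sum_le_sum fun i _ => hi i).trans ?_
  rw [← Finset.mul_sum, Finset.sum_comm]
  refine mul_le_mul_of_nonneg_left (Finset.sum_le_sum fun j _ => ?_) (sq_nonneg _)
  rw [← sq]
  by_cases hjn : (j : ℕ) < n
  · rw [Finset.sum_eq_single ⟨j, hjn⟩]
    · simp
    · intro i _ hi
      rw [if_neg]
      exact fun h => hi (Fin.ext h)
    · simp
  · rw [Finset.sum_eq_zero]
    · positivity
    · intro i _
      rw [if_neg]
      intro h
      exact hjn (h ▸ i.2)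

/-- Pythagoras for the projection `V Vᵀ`; `V` need not be square. -/
theorem dotProduct_transpose_mulVec_add {V : Matrix (Fin d) (Fin m) ℝ} (hV : Vᵀ * V = 1)
    (u : Fin d → ℝ) :
    (u - (V * Vᵀ) *ᵥ u) ⬝ᵥ (u - (V * Vᵀ) *ᵥ u) + (Vᵀ *ᵥ u) ⬝ᵥ (Vᵀ *ᵥ u) = u ⬝ᵥ u := by
  have hi : (V * Vᵀ) * (V * Vᵀ) = V * Vᵀ := by
    calc _ = V * (Vᵀ * V) * Vᵀ := by simp only [Matrix.mul_assoc]
      _ = _ := by rw [hV, Matrix.mul_one]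
  have hs : (V * Vᵀ)ᵀ = V * Vᵀ := by rw [transpose_mul, transpose_transpose]
  rw [dotProduct_projection_compl_le hs hi, mulVec_dotProduct_mulVec (V * Vᵀ), hs, hi,
    mulVec_dotProduct_mulVec Vᵀ, transpose_transpose]
  ring

theorem IsSVD.mulVec_dotProduct_mulVec_le {X : Matrix (Fin N) (Fin d) ℝ}
    {U : Matrix (Fin N) (Fin n) ℝ} {σ : ℕ → ℝ} {V : Matrix (Fin d) (Fin m) ℝ} (hX : IsSVD X U σ V)
    {k : ℕ} (hkm : k ≤ m) (u : Fin d → ℝ) (hu : (firstCols V hkm)ᵀ *ᵥ u = 0) :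
    (X *ᵥ u) ⬝ᵥ (X *ᵥ u) ≤ σ k ^ 2 * (u ⬝ᵥ u) := by
  have hXu : X *ᵥ u = U *ᵥ (rectDiagonal n m σ *ᵥ (Vᵀ *ᵥ u)) := by
    rw [mulVec_mulVec, mulVec_mulVec, ← hX.decomposition]
  have hc : ∀ j : Fin m, (j : ℕ) < k → (Vᵀ *ᵥ u) j = 0 := by
    intro j hj
    have := congrFun hu ⟨j, hj⟩
    exact this
  rw [hXu, mulVec_dotProduct_mulVec U, hX.orthonormal_left, one_mulVec]
  refine (rectDiagonal_mulVec_le hX.antitone hX.nonneg _ hc).trans ?_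
  refine mul_le_mul_of_nonneg_left ?_ (sq_nonneg _)
  rw [← dotProduct_transpose_mulVec_add hX.orthonormal_right u]
  exact le_add_of_nonneg_left (dotProduct_self_nonneg_real _)

theorem firstCols_orthonormal {k : ℕ} {V : Matrix (Fin d) (Fin m) ℝ} (hV : Vᵀ * V = 1)
    (hkm : k ≤ m) : (firstCols V hkm)ᵀ * firstCols V hkm = 1 := by
  have h : (firstCols V hkm)ᵀ * firstCols V hkm =
      (Vᵀ * V).submatrix (Fin.castLE hkm) (Fin.castLE hkm) := rfl
  rw [h, hV, submatrix_one _ (Fin.castLE_injective hkm)]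

end SingularValues

/-! ### Bias and rank bounds for a fixed subset. -/

section Sketching

variable {d k : ℕ}

theorem sampling_orthonormal (T : Finset (Fin d)) : (sampling T)ᵀ * sampling T = 1 := by
  have h : (sampling T)ᵀ * sampling T =
      (((1 : Matrix (Fin d) (Fin d) ℝ)ᵀ * 1).submatrix (fun i : T => (i : Fin d))
        (fun i : T => (i : Fin d))) := rfl
  rw [h, Matrix.mul_one, transpose_one, submatrix_one _ Subtype.val_injective]

theorem sampling_transpose_mul (V : Matrix (Fin d) (Fin k) ℝ) (T : Finset (Fin d)) :
    (sampling T)ᵀ * V = V.submatrix (fun i : T => (i : Fin d)) id := by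
  ext i j
  simp [sampling, Matrix.mul_apply, Matrix.one_apply]

theorem rowGram_eq_transpose_mul (V : Matrix (Fin d) (Fin k) ℝ) (T : Finset (Fin d)) :
    rowGram V T = ((sampling T)ᵀ * V)ᵀ * ((sampling T)ᵀ * V) := by
  rw [sampling_transpose_mul]
  ext i j
  simp only [rowGram, Matrix.of_apply, Matrix.mul_apply, transpose_apply, submatrix_apply, id_eq]
  exact (Finset.sum_coe_sort T fun r => V r i * V r j).symm

/-- A vector `c` supported on `T` whose image under `Vᵀ` is that of `w`. -/
theorem exists_sampling_comparison {V : Matrix (Fin d) (Fin k) ℝ} (hV : Vᵀ * V = 1)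
    {T : Finset (Fin d)} (hT : (rowGram V T).det ≠ 0) (w : Fin d → ℝ) :
    ∃ c : T → ℝ, Vᵀ *ᵥ (w - sampling T *ᵥ c) = 0 ∧
      (w - sampling T *ᵥ c) ⬝ᵥ (w - sampling T *ᵥ c) ≤
        (1 + (rowGram V T)⁻¹.trace) * (w ⬝ᵥ w) := by
  obtain ⟨W, hW⟩ : ∃ W, W = (sampling T)ᵀ * V := ⟨_, rfl⟩
  have hG : rowGram V T = Wᵀ * W := by rw [hW, rowGram_eq_transpose_mul]
  have hsymm : (rowGram V T)ᵀ = rowGram V T := isHermitian_rowGram V T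
  obtain ⟨G, hGdef⟩ : ∃ G, G = rowGram V T := ⟨_, rfl⟩
  rw [← hGdef] at hT hG hsymm ⊢
  have hunit : IsUnit G.det := isUnit_iff_ne_zero.mpr hT
  obtain ⟨b, hb⟩ : ∃ b, b = Vᵀ *ᵥ w := ⟨_, rfl⟩
  -- The least-norm solution of `Wᵀ c = b`. Its squared norm is at most `tr G⁻¹ ‖b‖²`, since `W G⁻¹`
  -- has squared Frobenius norm `tr G⁻¹`.
  obtain ⟨c, hc⟩ : ∃ c, c = (W * G⁻¹) *ᵥ b := ⟨_, rfl⟩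
  have hVS : Vᵀ * sampling T = Wᵀ := by rw [hW, transpose_mul, transpose_transpose]
  have hzero : Vᵀ *ᵥ (w - sampling T *ᵥ c) = 0 := by
    rw [mulVec_sub, mulVec_mulVec, hVS, hc, mulVec_mulVec, ← Matrix.mul_assoc, ← hG,
      mul_nonsing_inv _ hunit, one_mulVec, hb, sub_self]
  refine ⟨c, hzero, ?_⟩
  obtain ⟨s, hs⟩ : ∃ s, s = sampling T *ᵥ c := ⟨_, rfl⟩
  obtain ⟨t, ht⟩ : ∃ t, t = G⁻¹.trace := ⟨_, rfl⟩
  have hss : s ⬝ᵥ s ≤ t * (b ⬝ᵥ b) := by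
    rw [hs, mulVec_dotProduct_mulVec, sampling_orthonormal, one_mulVec, hc]
    refine (mulVec_dotProduct_mulVec_le_frobenius _ _).trans_eq ?_
    rw [ht, transpose_mul, Matrix.mul_assoc, ← Matrix.mul_assoc Wᵀ, ← hG,
      mul_nonsing_inv _ hunit, Matrix.mul_one, transpose_nonsing_inv, hsymm]
  have ht0 : 0 ≤ t := by
    have : t = ((W * G⁻¹)ᵀ * (W * G⁻¹)).trace := by
      rw [ht, transpose_mul, Matrix.mul_assoc, ← Matrix.mul_assoc Wᵀ, ← hG,
        mul_nonsing_inv _ hunit, Matrix.mul_one, transpose_nonsing_inv, hsymm]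
    rw [this]
    refine Finset.sum_nonneg fun i _ => ?_
    rw [diag_apply, Matrix.mul_apply]
    exact Finset.sum_nonneg fun j _ => mul_self_nonneg _
  rw [← hs] at hzero ⊢
  rw [← ht]
  -- `a` and `q` are the parts of `w` and `s` orthogonal to the columns of `V`; the remaining parts
  -- agree, so `w - s = a - q`.
  obtain ⟨a, ha⟩ : ∃ a, a = w - (V * Vᵀ) *ᵥ w := ⟨_, rfl⟩
  obtain ⟨q, hq⟩ : ∃ q, q = s - (V * Vᵀ) *ᵥ s := ⟨_, rfl⟩
  have hwdec : a ⬝ᵥ a + b ⬝ᵥ b = w ⬝ᵥ w := by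
    rw [ha, hb]; exact dotProduct_transpose_mulVec_add hV w
  have hqs : q ⬝ᵥ q ≤ s ⬝ᵥ s := by
    have := dotProduct_transpose_mulVec_add hV s
    rw [← hq] at this
    linarith [dotProduct_self_nonneg_real (Vᵀ *ᵥ s)]
  have hu : w - s = a - q := by
    have h0 : (V * Vᵀ) *ᵥ (w - s) = 0 := by rw [← mulVec_mulVec, hzero, mulVec_zero]
    rw [mulVec_sub] at h0
    rw [ha, hq, sub_sub_sub_comm, h0, sub_zero]
  have hA := dotProduct_self_nonneg_real a
  have hB := dotProduct_self_nonneg_real b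
  have hq' : q ⬝ᵥ q ≤ t * (b ⬝ᵥ b) := hqs.trans hss
  -- Cauchy–Schwarz, then AM–GM: `2 |a·q| ≤ 2 √t ‖a‖ ‖b‖ ≤ t ‖a‖² + ‖b‖²`. This makes the constant
  -- `1 + t` and not `2 (1 + t)`.
  have hcs : (2 * (a ⬝ᵥ q)) ^ 2 ≤ (t * (a ⬝ᵥ a) + b ⬝ᵥ b) ^ 2 := by
    have h1 := (dotProduct_sq_le a q).trans (mul_le_mul_of_nonneg_left hq' hA)
    nlinarith [sq_nonneg (t * (a ⬝ᵥ a) - b ⬝ᵥ b)]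
  have habs := abs_le_of_sq_le_sq' hcs (by positivity)
  rw [hu, ← hwdec, sub_dotProduct, dotProduct_sub, dotProduct_sub, dotProduct_comm q a]
  nlinarith [habs.1, habs.2]

/-- Each diagonal entry satisfies `R i i = ∑ j, R i j ^ 2 ≥ R i i ^ 2`, hence is at most `1`. -/
theorem trace_le_card_of_projection {n : Type*} [Fintype n] {R : Matrix n n ℝ}
    (hs : Rᵀ = R) (hi : R * R = R) : R.trace ≤ Fintype.card n := by
  have h : ∀ i, R i i ≤ 1 := by
    intro i
    have h1 : R i i = ∑ j, R i j ^ 2 := by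
      have := congrFun (congrFun hi i) i
      rw [Matrix.mul_apply] at this
      rw [← this]
      refine Finset.sum_congr rfl fun j _ => ?_
      have hij : R j i = R i j := congrFun (congrFun hs i) j
      rw [hij, sq]
    have h2 : R i i ^ 2 ≤ R i i := by
      conv_rhs => rw [h1]
      exact Finset.single_le_sum (f := fun j => R i j ^ 2) (fun j _ => sq_nonneg _)
        (Finset.mem_univ i)
    nlinarith
  calc R.trace ≤ ∑ _i : n, (1 : ℝ) := Finset.sum_le_sum fun i _ => h i
    _ = _ := by simp

/-- `A A⁺` is an orthogonal projection, so its squared Frobenius norm is its trace, equal to that of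
the projection `A⁺ A` on the smaller index type `n` of selected columns. -/
theorem sum_sq_mul_pinv_le {m n : Type*} [Fintype m] [Fintype n] [DecidableEq n]
    (A : Matrix m n ℝ) : ∑ i, ∑ j, (A * pinv A) i j ^ 2 ≤ Fintype.card n := by
  obtain ⟨h1, h2, h3, h4⟩ := pinv_penrose A
  have hsum : ∑ i, ∑ j, (A * pinv A) i j ^ 2 = ((A * pinv A) * (A * pinv A)ᵀ).trace := by
    simp only [Matrix.trace, diag_apply, Matrix.mul_apply (M := A * pinv A), transpose_apply,
      ← sq]
  rw [hsum, h3, ← Matrix.mul_assoc, h1, Matrix.trace_mul_comm]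
  exact trace_le_card_of_projection h4 (by rw [← Matrix.mul_assoc, h2])

/-- `A A⁺` fixes `A c`, so `z` and `z - A c` have the same residual, and projecting does not
increase the norm. -/
theorem residual_le {m n : Type*} [Fintype m] [DecidableEq m] [Fintype n] [DecidableEq n]
    (A : Matrix m n ℝ) (z : m → ℝ) (c : n → ℝ) :
    (z - (A * pinv A) *ᵥ z) ⬝ᵥ (z - (A * pinv A) *ᵥ z) ≤ (z - A *ᵥ c) ⬝ᵥ (z - A *ᵥ c) := by
  obtain ⟨h1, -, h3, -⟩ := pinv_penrose A
  have h : z - (A * pinv A) *ᵥ z = (z - A *ᵥ c) - (A * pinv A) *ᵥ (z - A *ᵥ c) := by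
    rw [mulVec_sub, mulVec_mulVec, h1]
    abel
  rw [h, dotProduct_projection_compl_le h3 (by rw [← Matrix.mul_assoc, h1])]
  exact sub_le_self _ (dotProduct_self_nonneg_real _)

theorem IsSVD.bias_le {N n m : ℕ} {X : Matrix (Fin N) (Fin d) ℝ}
    {U : Matrix (Fin N) (Fin n) ℝ} {σ : ℕ → ℝ} {V : Matrix (Fin d) (Fin m) ℝ} (hX : IsSVD X U σ V)
    (hkm : k ≤ m) {T : Finset (Fin d)} (hT : (rowGram (firstCols V hkm) T).det ≠ 0)
    (w : Fin d → ℝ) :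
    (X *ᵥ w - ((X * sampling T) * pinv (X * sampling T)) *ᵥ (X *ᵥ w)) ⬝ᵥ
      (X *ᵥ w - ((X * sampling T) * pinv (X * sampling T)) *ᵥ (X *ᵥ w)) ≤
        σ k ^ 2 * ((1 + (rowGram (firstCols V hkm) T)⁻¹.trace) * (w ⬝ᵥ w)) := by
  obtain ⟨c, hc0, hc⟩ := exists_sampling_comparison
    (firstCols_orthonormal hX.orthonormal_right hkm) hT w
  refine (residual_le _ _ c).trans ?_
  rw [← mulVec_mulVec, ← mulVec_sub]
  exact (hX.mulVec_dotProduct_mulVec_le hkm _ hc0).trans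
    (mul_le_mul_of_nonneg_left hc (sq_nonneg _))

end Sketching

/-! ### Bias–variance decomposition of the excess risk. -/

section Noise

/-- Cross terms vanish by centring, and independence makes the variance of each linear form
additive. -/
theorem integral_sum_sq_sub_mulVec {Ω : Type*} [MeasurableSpace Ω] (Q : Measure Ω)
    [IsProbabilityMeasure Q] {N : ℕ} (ξ : Fin N → Ω → ℝ) {v : ℝ} (hindep : iIndepFun ξ Q)
    (hmemLp : ∀ i, MemLp (ξ i) 2 Q) (hmean : ∀ i, ∫ ω, ξ i ω ∂Q = 0)
    (hvar : ∀ i, variance (ξ i) Q = v) {m : Type*} [Fintype m] (a : m → ℝ)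
    (M : Matrix m (Fin N) ℝ) :
    ∫ ω, ∑ i, (a i - ∑ j, M i j * ξ j ω) ^ 2 ∂Q = a ⬝ᵥ a + v * ∑ i, ∑ j, M i j ^ 2 := by
  have hZ : ∀ i, MemLp (fun ω => ∑ j, M i j * ξ j ω) 2 Q := fun i =>
    memLp_finsetSum _ fun j _ => (hmemLp j).const_mul _
  have hint : ∀ i, ∫ ω, (∑ j, M i j * ξ j ω) ∂Q = 0 := by
    intro i
    rw [integral_finsetSum _ fun j _ => ((hmemLp j).const_mul _).integrable one_le_two]
    refine Finset.sum_eq_zero fun j _ => ?_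
    rw [integral_const_mul, hmean, mul_zero]
  have hvarZ : ∀ i, ∫ ω, (∑ j, M i j * ξ j ω) ^ 2 ∂Q = v * ∑ j, M i j ^ 2 := by
    intro i
    rw [← variance_of_integral_eq_zero (hZ i).aestronglyMeasurable.aemeasurable (hint i)]
    have hfun : (fun ω => ∑ j, M i j * ξ j ω) = ∑ j, fun ω => M i j * ξ j ω := by
      ext ω
      rw [Finset.sum_apply]
    rw [hfun, IndepFun.variance_sum (fun j _ => (hmemLp j).const_mul _), Finset.mul_sum]
    · refine Finset.sum_congr rfl fun j _ => ?_
      rw [variance_const_mul, hvar, mul_comm]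
    · intro j _ l _ hjl
      exact (hindep.indepFun hjl).comp (measurable_const_mul (M i j)) (measurable_const_mul (M i l))
  have hint_sq : ∀ i, Integrable (fun ω => (a i - ∑ j, M i j * ξ j ω) ^ 2) Q := fun i =>
    ((memLp_const (a i)).sub (hZ i)).integrable_sq
  rw [integral_finsetSum _ fun i _ => hint_sq i]
  have hterm : ∀ i, ∫ ω, (a i - ∑ j, M i j * ξ j ω) ^ 2 ∂Q = a i * a i + v * ∑ j, M i j ^ 2 := by
    intro i
    have hexp : ∀ ω, (a i - ∑ j, M i j * ξ j ω) ^ 2 =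
        (a i * a i - 2 * a i * ∑ j, M i j * ξ j ω) + (∑ j, M i j * ξ j ω) ^ 2 := fun ω => by ring
    have hI : Integrable (fun ω => 2 * a i * ∑ j, M i j * ξ j ω) Q :=
      ((hZ i).integrable one_le_two).const_mul _
    simp_rw [hexp]
    have hJ : Integrable (fun ω => a i * a i - 2 * a i * ∑ j, M i j * ξ j ω) Q :=
      (integrable_const _).sub hI
    rw [integral_add hJ (hZ i).integrable_sq,
      integral_sub (integrable_const _) hI, integral_const_mul (2 * a i), hint, hvarZ]
    simp
  rw [Finset.sum_congr rfl fun i _ => hterm i, Finset.sum_add_distrib, Finset.mul_sum]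
  rfl

theorem excessRisk_sketchedLS {Ω : Type*} [MeasurableSpace Ω] (Q : Measure Ω)
    [IsProbabilityMeasure Q] {N d : ℕ} (ξ : Fin N → Ω → ℝ) {v : ℝ} (hindep : iIndepFun ξ Q)
    (hmemLp : ∀ i, MemLp (ξ i) 2 Q) (hmean : ∀ i, ∫ ω, ξ i ω ∂Q = 0)
    (hvar : ∀ i, variance (ξ i) Q = v) (X : Matrix (Fin N) (Fin d) ℝ)
    (w : EuclideanSpace ℝ (Fin d)) (T : Finset (Fin d)) (R : Matrix (Fin N) (Fin N) ℝ)
    (hR : R = (X * sampling T) * pinv (X * sampling T)) :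
    excessRisk Q ξ X w (sketchedLS X T) =
      ((X *ᵥ w.ofLp - R *ᵥ (X *ᵥ w.ofLp)) ⬝ᵥ (X *ᵥ w.ofLp - R *ᵥ (X *ᵥ w.ofLp)) +
        v * ∑ i, ∑ j, R i j ^ 2) / N := by
  rw [← integral_sum_sq_sub_mulVec Q ξ hindep hmemLp hmean hvar, ← integral_div]
  unfold excessRisk
  congr 1
  funext ω
  congr 1
  rw [EuclideanSpace.real_norm_sq_eq]
  refine Finset.sum_congr rfl fun i _ => ?_
  congr 1
  have h : X *ᵥ (sampling T *ᵥ (pinv (X * sampling T) *ᵥ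
      (X *ᵥ w.ofLp + fun i => ξ i ω))) = R *ᵥ (X *ᵥ w.ofLp) + R *ᵥ (fun i => ξ i ω) := by
    rw [mulVec_mulVec, mulVec_mulVec, ← hR, mulVec_add]
  have h' := congrFun h i
  simp only [Pi.add_apply] at h'
  change (X *ᵥ w.ofLp) i - (X *ᵥ (sampling T *ᵥ (pinv (X * sampling T) *ᵥ
      (X *ᵥ w.ofLp + fun i => ξ i ω)))) i = _
  rw [h', Pi.sub_apply, sub_add_eq_sub_sub]
  rfl

end Noise

/-! ### The leading indices and the effective sparsity level. -/

section Tail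

variable {d : ℕ}

/-- The indices that `π` ranks among the first `q` ones. -/
def head (π : Equiv.Perm (Fin d)) (q : ℕ) : Finset (Fin d) :=
  (Finset.univ.filter (fun i : Fin d => (i : ℕ) < q)).map π.toEmbedding

theorem disjoint_tail_iff (π : Equiv.Perm (Fin d)) (q : ℕ) (T : Finset (Fin d)) :
    Disjoint T (tail π q) ↔ T ⊆ head π q := by
  have hmem : ∀ x, x ∈ head π q ↔ x ∉ tail π q := by
    intro x
    simp [head, tail]
  rw [Finset.disjoint_left]
  exact ⟨fun h x hx => (hmem x).mpr (h hx), fun h x hx => (hmem x).mp (h hx)⟩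

theorem card_head (π : Equiv.Perm (Fin d)) {q : ℕ} (hq : q ≤ d) : (head π q).card = q := by
  rw [head, Finset.card_map, Fin.card_filter_val_lt, min_eq_right hq]

theorem sum_leverage {k : ℕ} {V : Matrix (Fin d) (Fin k) ℝ} (hV : Vᵀ * V = 1) :
    ∑ j, leverage V j = k := by
  have h := congrArg Matrix.trace hV
  rw [trace_one, Fintype.card_fin] at h
  rw [← h]
  simp only [leverage, Matrix.trace, diag_apply, Matrix.mul_apply, transpose_apply, ← sq]
  exact Finset.sum_comm

theorem effSparsity_spec {k : ℕ} (hk : 0 < k) {V : Matrix (Fin d) (Fin k) ℝ} (hV : Vᵀ * V = 1)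
    (π : Equiv.Perm (Fin d)) {θ : ℝ} (hθ : 1 < θ) :
    effSparsity k (leverage V) π θ ≤ d ∧
      (k : ℝ) - 1 + 1 / θ ≤ ∑ r ∈ head π (effSparsity k (leverage V) π θ), leverage V r := by
  have hd : 1 ≤ d := by
    rcases Nat.eq_zero_or_pos d with rfl | h
    · have := sum_leverage hV
      rw [Finset.univ_eq_empty, Finset.sum_empty] at this
      exact absurd (by exact_mod_cast this.symm) hk.ne'
    · exact h
  have hmem : effSparsity k (leverage V) π θ ∈ {q : ℕ | 1 ≤ q ∧ q ≤ d ∧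
      (k : ℝ) - 1 + 1 / θ ≤
        ∑ i ∈ Finset.univ.filter (fun i : Fin d => (i : ℕ) < q), leverage V (π i)} := by
    -- The infimum is attained only if the set is nonempty; `q = d` belongs to it because all the
    -- scores sum to `k`.
    refine Nat.sInf_mem ⟨d, hd, le_rfl, ?_⟩
    rw [Finset.filter_true_of_mem fun i _ => i.2, Equiv.sum_comp π, sum_leverage hV]
    have : 1 / θ ≤ 1 := by rw [div_le_one (by linarith)]; exact hθ.le
    linarith
  refine ⟨hmem.2.1, hmem.2.2.trans_eq ?_⟩
  rw [head, Finset.sum_map]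
  rfl

end Tail

/-! ### The law of the projection DPP. -/

section ProjectionDPP

variable {Ω : Type*} [MeasurableSpace Ω] {P : Measure Ω} {d k : ℕ}
  {V : Matrix (Fin d) (Fin k) ℝ} {Y : Ω → Finset (Fin d)}

theorem det_submatrix_mul_transpose_of_card_eq (V : Matrix (Fin d) (Fin k) ℝ)
    {T : Finset (Fin d)} (hT : T.card = k) :
    ((V * Vᵀ).submatrix (fun i : T => (i : Fin d)) (fun i : T => (i : Fin d))).det =
      (rowGram V T).det := by
  obtain ⟨e⟩ : Nonempty (T ≃ Fin k) := ⟨T.equivFinOfCardEq hT⟩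
  obtain ⟨W, hW⟩ : ∃ W : Matrix (Fin k) (Fin k) ℝ,
      W = V.submatrix (fun i => ((e.symm i : T) : Fin d)) id := ⟨_, rfl⟩
  have h1 : ((V * Vᵀ).submatrix (fun i : T => (i : Fin d)) (fun i : T => (i : Fin d))) =
      (W * Wᵀ).submatrix e e := by
    ext i j
    simp [hW, Matrix.mul_apply]
  have h2 : rowGram V T = Wᵀ * W := by
    ext i j
    simp only [rowGram, hW, Matrix.of_apply, Matrix.mul_apply, transpose_apply, submatrix_apply,
      id_eq]
    rw [Equiv.sum_comp e.symm fun r : T => V r i * V r j]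
    exact (Finset.sum_coe_sort T fun r => V r i * V r j).symm
  rw [h1, h2, det_submatrix_equiv_self, det_mul_comm]

/-- The kernel factors through dimension `k`, so a larger principal submatrix is rank deficient. -/
theorem det_submatrix_mul_transpose_of_lt_card (V : Matrix (Fin d) (Fin k) ℝ)
    {T : Finset (Fin d)} (hT : k < T.card) :
    ((V * Vᵀ).submatrix (fun i : T => (i : Fin d)) (fun i : T => (i : Fin d))).det = 0 := by
  have h1 : ((V * Vᵀ).submatrix (fun i : T => (i : Fin d)) (fun i : T => (i : Fin d))) =
      V.submatrix (fun i : T => (i : Fin d)) id * (V.submatrix (fun i : T => (i : Fin d)) id)ᵀ :=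
    rfl
  rw [h1]
  by_contra hne
  have hu := (Matrix.isUnit_iff_isUnit_det _).mpr (isUnit_iff_ne_zero.mpr hne)
  have hr := rank_of_isUnit _ hu
  have hle := (rank_mul_le_left (V.submatrix (fun i : T => (i : Fin d)) id)
    (V.submatrix (fun i : T => (i : Fin d)) id)ᵀ).trans (rank_le_card_width _)
  rw [hr, Fintype.card_coe, Fintype.card_fin] at hle
  omega

theorem IsDPP.measurableSet_setOf (hY : IsDPP P (V * Vᵀ) Y) (p : Finset (Fin d) → Prop) :
    MeasurableSet {ω | p (Y ω)} :=
  hY.measurable (Set.toFinite {T | p T}).measurableSet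

variable [IsProbabilityMeasure P]

theorem IsDPP.card_le (hY : IsDPP P (V * Vᵀ) Y) : ∀ᵐ ω ∂P, (Y ω).card ≤ k := by
  have h : ∀ᵐ ω ∂P, ∀ T : Finset (Fin d), k < T.card → ¬ T ⊆ Y ω := by
    rw [ae_all_iff]
    intro T
    by_cases hT : k < T.card
    · have hz := hY.marginal T
      rw [det_submatrix_mul_transpose_of_lt_card V hT, measureReal_eq_zero_iff] at hz
      have : ∀ᵐ ω ∂P, ¬ T ⊆ Y ω := by
        rw [ae_iff]
        simpa only [not_not] using hz
      filter_upwards [this] with ω hω _ using hω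
    · exact Filter.Eventually.of_forall fun ω h => absurd h hT
  filter_upwards [h] with ω hω
  by_contra hlt
  exact hω (Y ω) (not_le.mp hlt) subset_rfl

theorem IsDPP.integral_card (hY : IsDPP P (V * Vᵀ) Y) (hV : Vᵀ * V = 1) :
    ∫ ω, ((Y ω).card : ℝ) ∂P = k := by
  have hcard : ∀ ω, ((Y ω).card : ℝ) = ∑ i, {ω | i ∈ Y ω}.indicator (fun _ => (1 : ℝ)) ω := by
    intro ω
    simp [Set.indicator_apply]
  have hmeas : ∀ i, MeasurableSet {ω | i ∈ Y ω} := fun i => hY.measurableSet_setOf (i ∈ ·)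
  simp_rw [hcard]
  rw [integral_finsetSum _ fun i _ => (integrable_const _).indicator (hmeas i), ← sum_leverage hV]
  refine Finset.sum_congr rfl fun i _ => ?_
  rw [integral_indicator_const _ (hmeas i), smul_eq_mul, mul_one]
  have h := hY.marginal {i}
  simp only [Finset.singleton_subset_iff] at h
  rw [h, det_unique]
  simp only [submatrix_apply, Matrix.mul_apply, transpose_apply, leverage, sq]
  have hi : ((default : ({i} : Finset (Fin d))) : Fin d) = i :=
    Finset.mem_singleton.mp (default : ({i} : Finset (Fin d))).2
  rw [hi]

theorem IsDPP.integrable_comp (hY : IsDPP P (V * Vᵀ) Y) (g : Finset (Fin d) → ℝ) :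
    Integrable (fun ω => g (Y ω)) P :=
  Integrable.comp_measurable (Integrable.of_finite (f := g)) hY.measurable

/-- The cardinality is almost surely at most `k` and has mean `tr K = k`, so it is almost surely
`k`. -/
theorem IsDPP.card_eq (hY : IsDPP P (V * Vᵀ) Y) (hV : Vᵀ * V = 1) :
    ∀ᵐ ω ∂P, (Y ω).card = k := by
  have hI := hY.integrable_comp fun T => (k : ℝ) - T.card
  have h0 : ∫ ω, ((k : ℝ) - (Y ω).card) ∂P = 0 := by
    rw [integral_sub (integrable_const _) (hY.integrable_comp fun T => (T.card : ℝ)),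
      hY.integral_card hV]
    simp
  rw [integral_eq_zero_iff_of_nonneg_ae _ hI] at h0
  · filter_upwards [h0] with ω hω
    have : (k : ℝ) - (Y ω).card = 0 := hω
    exact_mod_cast (sub_eq_zero.mp this).symm
  · filter_upwards [hY.card_le] with ω hω
    have : ((Y ω).card : ℝ) ≤ k := by exact_mod_cast hω
    simpa using this

/-- When `|T| = k`, the events `T ⊆ Y` and `Y = T` coincide almost surely, so the marginal is
already the point mass. -/
theorem IsDPP.measureReal_eq (hY : IsDPP P (V * Vᵀ) Y) (hV : Vᵀ * V = 1) (T : Finset (Fin d)) :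
    P.real {ω | Y ω = T} = if T.card = k then (rowGram V T).det else 0 := by
  split_ifs with hT
  · rw [← det_submatrix_mul_transpose_of_card_eq V hT, ← hY.marginal T]
    refine measureReal_congr ?_
    filter_upwards [hY.card_eq hV] with ω hω
    refine propext ⟨fun h => ?_, fun h => ?_⟩
    · exact (show Y ω = T from h) ▸ subset_rfl
    · exact (Finset.eq_of_subset_of_card_le (show T ⊆ Y ω from h) (by rw [hω, hT])).symm
  · rw [measureReal_eq_zero_iff]
    have : ∀ᵐ ω ∂P, ¬ Y ω = T := by
      filter_upwards [hY.card_eq hV] with ω hω h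
      exact hT (h ▸ hω)
    simpa only [ae_iff, not_not] using this

theorem IsDPP.integral_comp (hY : IsDPP P (V * Vᵀ) Y) (hV : Vᵀ * V = 1)
    (g : Finset (Fin d) → ℝ) :
    ∫ ω, g (Y ω) ∂P = ∑ T ∈ Finset.univ.powersetCard k, (rowGram V T).det * g T := by
  rw [← integral_map hY.measurable.aemeasurable
    (Integrable.of_finite (f := g)).aestronglyMeasurable, integral_fintype Integrable.of_finite,
    ← Finset.sum_subset (Finset.subset_univ (Finset.univ.powersetCard k))]
  · refine Finset.sum_congr rfl fun T hT => ?_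
    rw [map_measureReal_apply hY.measurable (measurableSet_singleton T), smul_eq_mul]
    change P.real {ω | Y ω = T} * _ = _
    rw [hY.measureReal_eq hV, if_pos (Finset.mem_powersetCard.mp hT).2]
  · intro T _ hT
    rw [map_measureReal_apply hY.measurable (measurableSet_singleton T), smul_eq_mul]
    change P.real {ω | Y ω = T} * _ = _
    rw [hY.measureReal_eq hV, if_neg, zero_mul]
    intro h
    exact hT (Finset.mem_powersetCard.mpr ⟨Finset.subset_univ _, h⟩)

theorem IsDPP.setIntegral_subset (hY : IsDPP P (V * Vᵀ) Y) (hV : Vᵀ * V = 1)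
    (L : Finset (Fin d)) (g : Finset (Fin d) → ℝ) :
    ∫ ω in {ω | Y ω ⊆ L}, g (Y ω) ∂P = ∑ T ∈ L.powersetCard k, (rowGram V T).det * g T := by
  rw [← integral_indicator (hY.measurableSet_setOf (· ⊆ L))]
  have h : ∀ ω, {ω | Y ω ⊆ L}.indicator (fun ω => g (Y ω)) ω =
      (fun T => if T ⊆ L then g T else 0) (Y ω) := by
    intro ω
    simp [Set.indicator_apply]
  simp_rw [h]
  rw [hY.integral_comp hV fun T => if T ⊆ L then g T else 0]
  simp_rw [mul_ite, mul_zero]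
  rw [← Finset.sum_filter]
  refine Finset.sum_congr ?_ fun _ _ => rfl
  ext T
  simp only [Finset.mem_filter, Finset.mem_powersetCard]
  exact ⟨fun h => ⟨h.2, h.1.2⟩, fun h => ⟨⟨Finset.subset_univ _, h.2⟩, h.1⟩⟩

theorem IsDPP.measureReal_subset (hY : IsDPP P (V * Vᵀ) Y) (hV : Vᵀ * V = 1)
    (L : Finset (Fin d)) : P.real {ω | Y ω ⊆ L} = (rowGram V L).det := by
  have h := hY.setIntegral_subset hV L fun _ => 1
  have hcb := det_rowGram_eq_sum_powersetCard V L
  rw [Fintype.card_fin] at hcb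
  simp only [mul_one, setIntegral_const, smul_eq_mul] at h
  rw [h, hcb]

theorem IsDPP.integral_cond_subset (hY : IsDPP P (V * Vᵀ) Y) (hV : Vᵀ * V = 1)
    (L : Finset (Fin d)) (g : Finset (Fin d) → ℝ) :
    ∫ ω, g (Y ω) ∂(P[|{ω | Y ω ⊆ L}]) =
      (rowGram V L).det⁻¹ * ∑ T ∈ L.powersetCard k, (rowGram V T).det * g T := by
  rw [ProbabilityTheory.cond, integral_smul_measure, hY.setIntegral_subset hV, ENNReal.toReal_inv,
    smul_eq_mul]
  congr 2
  exact hY.measureReal_subset hV L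

end ProjectionDPP

/-! ### Averaging the fixed-subset bound and conclusion. -/

/-- If `g T ≤ α (1 + tr (V_Tᵀ V_T)⁻¹) + β` whenever `V_Tᵀ V_T` is invertible, the mean of `g` under
the projection DPP restricted to subsets of `L` is at most the mean of that bound. -/
theorem sum_det_rowGram_mul_le {d k : ℕ} (hk : 0 < k) {V : Matrix (Fin d) (Fin k) ℝ}
    (L : Finset (Fin d)) {g : Finset (Fin d) → ℝ} {α β : ℝ} (hα : 0 ≤ α)
    (hg : ∀ T, T.card = k → (rowGram V T).det ≠ 0 →
      g T ≤ α * (1 + (rowGram V T)⁻¹.trace) + β) :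
    ∑ T ∈ L.powersetCard k, (rowGram V T).det * g T ≤
      α * ((rowGram V L).det + ((L.card : ℝ) - k + 1) * (rowGram V L).adjugate.trace) +
        β * (rowGram V L).det := by
  have hcb := det_rowGram_eq_sum_powersetCard V L
  rw [Fintype.card_fin] at hcb
  rw [← sum_trace_adjugate_rowGram hk, hcb, ← Finset.sum_add_distrib, Finset.mul_sum,
    Finset.mul_sum, ← Finset.sum_add_distrib]
  refine Finset.sum_le_sum fun T hT => ?_
  -- Nothing is known about `g T` when `G_T` is singular, but such `T` has weight zero on the left
  -- and a nonnegative term on the right.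
  by_cases hdet : (rowGram V T).det = 0
  · rw [hdet]
    have := mul_nonneg hα (trace_adjugate_rowGram_nonneg V T)
    simpa using this
  · have hpos := lt_of_le_of_ne (det_rowGram_nonneg V T) (Ne.symm hdet)
    have htr : (rowGram V T).det * (rowGram V T)⁻¹.trace = (rowGram V T).adjugate.trace := by
      rw [inv_def, trace_smul, Ring.inverse_eq_inv', smul_eq_mul, mul_inv_cancel_left₀ hdet]
    calc _ ≤ (rowGram V T).det * (α * (1 + (rowGram V T)⁻¹.trace) + β) :=
          mul_le_mul_of_nonneg_left (hg T (Finset.mem_powersetCard.mp hT).2 hdet) hpos.le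
      _ = α * ((rowGram V T).det + (rowGram V T).det * (rowGram V T)⁻¹.trace) +
          β * (rowGram V T).det := by ring
      _ = _ := by rw [htr]

end ColumnSubset

end

theorem mainTheorem5 {N d n m k : ℕ} (hN : 0 < N) (hk : 0 < k) (hkm : k ≤ m)
    -- the data matrix and a singular value decomposition of it
    (X : Matrix (Fin N) (Fin d) ℝ)
    (U : Matrix (Fin N) (Fin n) ℝ) (σ : ℕ → ℝ) (V : Matrix (Fin d) (Fin m) ℝ)
    (hX : ColumnSubset.IsSVD X U σ V)
    -- the linear model, with i.i.d. centred noise of variance `v`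
    (wstar : EuclideanSpace ℝ (Fin d)) (v : ℝ)
    {Ω' : Type*} [MeasurableSpace Ω'] (Q : Measure Ω') [IsProbabilityMeasure Q]
    (ξ : Fin N → Ω' → ℝ) (hξ_indep : iIndepFun ξ Q)
    (hξ_ident : ∀ i j, IdentDistrib (ξ i) (ξ j) Q Q)
    (hξ_memLp : ∀ i, MemLp (ξ i) 2 Q)
    (hξ_mean : ∀ i, ∫ ω, ξ i ω ∂Q = 0) (hξ_var : ∀ i, variance (ξ i) Q = v)
    -- a permutation that sorts the `k`-leverage scores, and the parameter `θ`
    (π : Equiv.Perm (Fin d))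
    (hπ : Antitone fun i => ColumnSubset.leverage (ColumnSubset.firstCols V hkm) (π i))
    (θ : ℝ) (hθ : 1 < θ)
    -- the random subset, drawn from the projection DPP with marginal kernel `V_k V_kᵀ`
    {Ω : Type*} [MeasurableSpace Ω] (P : Measure Ω) [IsProbabilityMeasure P]
    (Y : Ω → Finset (Fin d))
    (hY : ColumnSubset.IsDPP P
      (ColumnSubset.firstCols V hkm * (ColumnSubset.firstCols V hkm)ᵀ) Y)
    -- the effective sparsity level and the conditioning event
    (p : ℕ)
    (hp : p = ColumnSubset.effSparsity k
      (ColumnSubset.leverage (ColumnSubset.firstCols V hkm)) π θ)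
    (A : Set Ω) (hA : A = {ω | Disjoint (Y ω) (ColumnSubset.tail π p)}) :
    0 < P A ∧
      ∫ ω, ColumnSubset.excessRisk Q ξ X wstar (ColumnSubset.sketchedLS X (Y ω)) ∂(P[|A]) ≤
        (1 + ((k : ℝ) - 1 + θ) * ((p : ℝ) - (k : ℝ) + 1)) * (‖wstar‖ ^ 2 * σ k ^ 2 / N)
          + v * k / N := by
  have hV : (ColumnSubset.firstCols V hkm)ᵀ * ColumnSubset.firstCols V hkm = 1 :=
    ColumnSubset.firstCols_orthonormal hX.orthonormal_right hkm
  obtain ⟨hpd, hsum⟩ := ColumnSubset.effSparsity_spec hk hV π hθ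
  rw [← hp] at hpd hsum
  have hcard := ColumnSubset.card_head π hpd
  obtain ⟨L, hL⟩ : ∃ L, L = ColumnSubset.head π p := ⟨_, rfl⟩
  obtain ⟨Vk, hVk⟩ : ∃ Vk, Vk = ColumnSubset.firstCols V hkm := ⟨_, rfl⟩
  have hA' : A = {ω | Y ω ⊆ L} := by
    rw [hA, hL]
    ext ω
    exact ColumnSubset.disjoint_tail_iff π p (Y ω)
  rw [← hL] at hsum hcard
  rw [← hVk] at hV hsum hY
  obtain ⟨hdet, htr⟩ := ColumnSubset.trace_adjugate_rowGram_le hV L hθ hsum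
  have hPA : P.real A = (ColumnSubset.rowGram Vk L).det := by
    rw [hA', hY.measureReal_subset hV]
  refine ⟨?_, ?_⟩
  · rw [pos_iff_ne_zero]
    intro h
    rw [Measure.real, h, ENNReal.toReal_zero] at hPA
    exact hdet.ne hPA
  have hv : 0 ≤ v := by
    rw [← hξ_var ⟨0, hN⟩]
    exact variance_nonneg _ _
  have hNpos : (0 : ℝ) < N := by exact_mod_cast hN
  have hw : wstar.ofLp ⬝ᵥ wstar.ofLp = ‖wstar‖ ^ 2 := by
    rw [EuclideanSpace.real_norm_sq_eq]
    simp only [dotProduct, ← sq]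
  -- A nonzero Cauchy–Binet term of `det G_L` exhibits a `k`-subset of `L`. This gives the sign of
  -- `p - k + 1` needed to multiply the trace bound by it.
  have hkp : (k : ℝ) ≤ p := by
    have hne : (ColumnSubset.rowGram Vk L).det ≠ 0 := hdet.ne'
    rw [ColumnSubset.det_rowGram_eq_sum_powersetCard, Fintype.card_fin] at hne
    obtain ⟨T, hT, -⟩ := Finset.exists_ne_zero_of_sum_ne_zero hne
    rw [Finset.mem_powersetCard] at hT
    rw [← hcard, ← hT.2]
    exact_mod_cast Finset.card_le_card hT.1
  have hg : ∀ T : Finset (Fin d), T.card = k → (ColumnSubset.rowGram Vk T).det ≠ 0 →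
      ColumnSubset.excessRisk Q ξ X wstar (ColumnSubset.sketchedLS X T) ≤
        ‖wstar‖ ^ 2 * σ k ^ 2 / N * (1 + (ColumnSubset.rowGram Vk T)⁻¹.trace) + v * k / N := by
    intro T hT hne
    rw [ColumnSubset.excessRisk_sketchedLS Q ξ hξ_indep hξ_memLp hξ_mean hξ_var X wstar T _ rfl]
    have hbias := hX.bias_le hkm (hVk ▸ hne) wstar.ofLp
    rw [← hVk, hw] at hbias
    have hnoise := ColumnSubset.sum_sq_mul_pinv_le (X * ColumnSubset.sampling T)
    rw [Fintype.card_coe, hT] at hnoise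
    refine (div_le_div_of_nonneg_right
      (add_le_add hbias (mul_le_mul_of_nonneg_left hnoise hv)) hNpos.le).trans_eq ?_
    ring
  have hα : 0 ≤ ‖wstar‖ ^ 2 * σ k ^ 2 / N := by positivity
  have hbound := ColumnSubset.sum_det_rowGram_mul_le hk L hα hg
  rw [hcard] at hbound
  rw [hA', hY.integral_cond_subset hV L fun T =>
    ColumnSubset.excessRisk Q ξ X wstar (ColumnSubset.sketchedLS X T), inv_mul_le_iff₀ hdet]
  refine hbound.trans ?_
  have h1 := mul_le_mul_of_nonneg_left htr (by linarith : 0 ≤ (p : ℝ) - k + 1)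
  have h2 := mul_le_mul_of_nonneg_left h1 hα
  linarith
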